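/- Let $G$ be a discrete group, let $X$ be a nonempty compact Hausdorff space, and suppose that $G$ acts on $X$ by homeomorphisms in such a way that the action is minimal (every orbit is dense) and such that for every finite set $S \subset G \setminus \{1\}$ the set \[ \{ x \in X : g x \neq x \text{ for all } g \in S \} \] is dense in $X$. Let $D$ be a simple unital C*-algebra, and let $\alpha \colon G \to \mathrm{Aut}(C(X,D))$ be an action of $G$ on $C(X,D)$ which lies over the given action of $G$ on $X$, that is, there is a function $(g,x) \mapsto \alpha_{g,x}$ from $G \times X$ to $\mathrm{Aut}(D)$ such that $\alpha_g(a)(x) = \alpha_{g,x}(a(g^{-1}x))$ for all $g \in G$, $x \in X$, and $a \in C(X,D)$. Then the reduced crossed product $C^*_{\mathrm{r}}(G, C(X,D), \alpha)$ is simple. Here a C*-algebra is called simple if it is nonzero and has no closed two-sided ideals other than $0$ and itself. For a faithful unital representation $\pi$ of $A = C(X,D)$ on a Hilbert space $H$, the algebra $C^*_{\mathrm{r}}(G, A, \alpha)$ is realized as the C*-algebra of operators on $\ell^2(G,H)$ generated by the operators $\tilde\pi(a)$, for $a \in A$, and $u_s$, for $s \in G$, where $(\tilde\pi(a)\xi)(g)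 = \pi(\alpha_{g^{-1}}(a))(\xi(g))$ and $(u_s\xi)(g) = \xi(s^{-1}g)$. The statement is asserted for every choice of faithful $\pi$. -/

import Mathlib

noncomputable section

open scoped ENNReal

namespace ReducedCrossedProduct

/-- A C*-algebra is simple if it is nonzero and has no closed two-sided ideals besides `0` and the
whole algebra. -/
def IsSimpleCStar (A : Type*) [Ring A] [TopologicalSpace A] : Prop :=
  Nontrivial A ∧ ∀ I : TwoSidedIdeal A, IsClosed (I : Set A) → I = ⊥ ∨ I = ⊤

section Over

variable {G X D : Type*} [Group G] [TopologicalSpace X] [CompactSpace X] [MulAction G X]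
  [CStarAlgebra D]

/-- The action `α` of `G` on `C(X, D)` lies over the given action of `G` on `X`: there are
automorphisms `β g x` of `D` with `α_g(a)(x) = β_{g, x}(a(g⁻¹ x))`. -/
def LiesOver (α : G →* (C(X, D) ≃⋆ₐ[ℂ] C(X, D))) : Prop :=
  ∃ β : G → X → (D ≃⋆ₐ[ℂ] D), ∀ (g : G) (a : C(X, D)) (x : X), α g a x = β g x (a (g⁻¹ • x))

end Over

section CrossedProduct

variable {G A H : Type*} [Group G] [CStarAlgebra A]
  [NormedAddCommGroup H] [InnerProductSpace ℂ H] [CompleteSpace H]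

/-- The Hilbert space `ℓ²(G, H)` of square summable functions from `G` to `H`. -/
abbrev EllTwo (G H : Type*) [NormedAddCommGroup H] : Type _ := lp (fun _ : G => H) 2

/-- The operator `a ↦ π̃(a)` of the regular representation:
`(π̃(a) ξ)(g) = π(α_{g⁻¹}(a)) (ξ(g))`. -/
def regularRep (α : G →* (A ≃⋆ₐ[ℂ] A)) (π : A →⋆ₐ[ℂ] (H →L[ℂ] H)) (a : A) :
    EllTwo G H →L[ℂ] EllTwo G H :=
  lp.mapCLM 2 (fun g : G => π (α g⁻¹ a)) (norm_nonneg a) fun g =>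
    (NonUnitalStarAlgHom.norm_apply_le π (α g⁻¹ a)).trans
      (NonUnitalStarAlgHom.norm_apply_le (α g⁻¹) a)

theorem regularRep_apply (α : G →* (A ≃⋆ₐ[ℂ] A)) (π : A →⋆ₐ[ℂ] (H →L[ℂ] H)) (a : A)
    (ξ : EllTwo G H) (g : G) : regularRep α π a ξ g = π (α g⁻¹ a) (ξ g) := rfl

theorem memℓp_translate {G H : Type*} [Group G] [NormedAddCommGroup H] (s : G) (ξ : EllTwo G H) : Memℓp (fun g : G => ξ (s⁻¹ * g)) 2 := by
  have h := (memℓp_gen_iff (p := 2) (by norm_num)).1 (lp.memℓp ξ)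
  exact memℓp_gen ((Equiv.mulLeft s⁻¹).summable_iff.2 h)

/-- Left translation by `s` on `ℓ²(G, H)`, that is, `(u_s ξ)(g) = ξ(s⁻¹ g)`. -/
def translation (s : G) : EllTwo G H →L[ℂ] EllTwo G H :=
  LinearMap.mkContinuous
    { toFun := fun ξ => ⟨fun g => ξ (s⁻¹ * g), memℓp_translate s ξ⟩
      map_add' := fun _ _ => rfl
      map_smul' := fun _ _ => rfl } 1 fun ξ => by
    refine le_of_eq ?_
    rw [one_mul, lp.norm_eq_tsum_rpow (by norm_num), lp.norm_eq_tsum_rpow (by norm_num)]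
    congr 1
    exact (Equiv.mulLeft s⁻¹).tsum_eq fun g => ‖ξ g‖ ^ (2 : ℝ≥0∞).toReal

theorem translation_apply {G H : Type*} [Group G] [NormedAddCommGroup H] [InnerProductSpace ℂ H]
    (s : G) (ξ : EllTwo G H) (g : G) :
    translation s ξ g = ξ (s⁻¹ * g) := rfl

/-- The reduced crossed product `C*_r(G, A, α)` of the discrete group `G`, realized through the
representation `π` of `A` on `H`: the C*-algebra of operators on `ℓ²(G, H)` generated by the
operators `π̃(a)` for `a ∈ A` and the unitaries `u_s` for `s ∈ G`. If `π` is faithful, then it does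
not depend on `π` up to isomorphism. -/
def reducedCrossedProduct (α : G →* (A ≃⋆ₐ[ℂ] A)) (π : A →⋆ₐ[ℂ] (H →L[ℂ] H)) :
    StarSubalgebra ℂ (EllTwo G H →L[ℂ] EllTwo G H) :=
  (StarAlgebra.adjoin ℂ
    (Set.range (regularRep α π) ∪
      Set.range (translation : G → EllTwo G H →L[ℂ] EllTwo G H))).topologicalClosure

end CrossedProduct

end ReducedCrossedProduct

end

/-! The matrix coefficient at the identity, `entry`, plays the role of the conditional expectation
onto `C(X, D)`. It is faithful on positive elements after translation, so a nonzero ideal `I`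
contains some `y` with nonzero coefficient `c` (`exists_mem_entry_ne_zero`). Simplicity of `D`
allows `c` to be taken close to 1 at a point, hence on an open set
(`exists_mem_norm_entry_sub_one_lt`).

Freeness then removes the other coefficients. A finite sum near `y` is compressed by a bump function
`f` whose support is disjoint from its relevant translates, and only the identity coefficient
survives (`exists_compression`). So `f y f` is at distance less than 1 from `f²`, and a Neumann
series puts a nonzero function `k ≥ 0` in `I` (`exists_nonneg_scalar_mem`). By minimality and
compactness finitely many translates of `k` add up to an invertible function, so `1 ∈ I`
(`one_mem_of_scalar_mem`). -/

namespace ReducedCrossedProduct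

/-! ### Translations and the coefficient at the identity. -/

section Operators

variable {G H : Type*} [Group G] [NormedAddCommGroup H] [InnerProductSpace ℂ H]

theorem translation_one : (translation (1 : G) : EllTwo G H →L[ℂ] EllTwo G H) = 1 := by
  ext ξ g
  simp [translation_apply]

theorem translation_mul (s t : G) :
    (translation (s * t) : EllTwo G H →L[ℂ] EllTwo G H) = translation s * translation t := by
  ext ξ g
  simp [translation_apply, mul_assoc]

open scoped Classical in
/-- The matrix coefficient at the identity of an operator on `ℓ²(G, H)`. -/
noncomputable def entry : (EllTwo G H →L[ℂ] EllTwo G H) →ₗ[ℂ] (H →L[ℂ] H) where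
  toFun T := LinearMap.mkContinuous
    { toFun := fun v => T (lp.single 2 1 v) 1
      map_add' := fun v w => by simp [lp.single_add]
      map_smul' := fun c v => by simp [lp.single_smul] } ‖T‖ fun v =>
    (lp.norm_apply_le_norm two_ne_zero _ _).trans <| (T.le_opNorm _).trans <| by
      rw [lp.norm_single (by norm_num)]
  map_add' S T := rfl
  map_smul' c T := rfl

open scoped Classical in
theorem entry_apply (T : EllTwo G H →L[ℂ] EllTwo G H) (v : H) :
    entry T v = T (lp.single 2 1 v) 1 := rfl

theorem norm_entry_le (T : EllTwo G H →L[ℂ] EllTwo G H) : ‖entry T‖ ≤ ‖T‖ := by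
  classical
  refine ContinuousLinearMap.opNorm_le_bound _ (norm_nonneg T) fun v => ?_
  rw [entry_apply]
  refine (lp.norm_apply_le_norm two_ne_zero _ _).trans ((T.le_opNorm _).trans ?_)
  rw [lp.norm_single (by norm_num)]

theorem continuous_entry :
    Continuous (entry : (EllTwo G H →L[ℂ] EllTwo G H) → (H →L[ℂ] H)) :=
  AddMonoidHomClass.continuous_of_bound (entry (G := G) (H := H)) 1 fun T => by
    simpa using norm_entry_le T

theorem entry_one : entry (1 : EllTwo G H →L[ℂ] EllTwo G H) = 1 := by
  ext v
  simp [entry_apply]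

theorem entry_translation {s : G} (hs : s ≠ 1) :
    entry (translation s : EllTwo G H →L[ℂ] EllTwo G H) = 0 := by
  ext v
  simp [entry_apply, translation_apply, hs]

end Operators

/-! ### Covariance, the dense span, and the conditional expectation. -/

section CrossedProduct

variable {G A H : Type*} [Group G] [CStarAlgebra A]
  [NormedAddCommGroup H] [InnerProductSpace ℂ H] [CompleteSpace H]
  (α : G →* (A ≃⋆ₐ[ℂ] A)) (π : A →⋆ₐ[ℂ] (H →L[ℂ] H))

theorem adjoint_translation (s : G) :
    star (translation s : EllTwo G H →L[ℂ] EllTwo G H) = translation s⁻¹ := by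
  rw [ContinuousLinearMap.star_eq_adjoint, eq_comm, ContinuousLinearMap.eq_adjoint_iff]
  intro ξ η
  rw [lp.inner_eq_tsum, lp.inner_eq_tsum, ← (Equiv.mulLeft s⁻¹).tsum_eq]
  refine tsum_congr fun g => ?_
  simp [translation_apply]

/-- The regular representation of the coefficient algebra as a star homomorphism. -/
noncomputable def regularRepHom : A →⋆ₐ[ℂ] (EllTwo G H →L[ℂ] EllTwo G H) where
  toFun := regularRep α π
  map_one' := by ext ξ g; simp [regularRep_apply]
  map_mul' a b := by ext ξ g; simp [regularRep_apply]
  map_zero' := by ext ξ g; simp [regularRep_apply]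
  map_add' a b := by ext ξ g; simp [regularRep_apply]
  commutes' r := by
    ext ξ g
    simp [regularRep_apply, Algebra.algebraMap_eq_smul_one]
  map_star' a := by
    rw [ContinuousLinearMap.star_eq_adjoint, ContinuousLinearMap.eq_adjoint_iff]
    intro ξ η
    rw [lp.inner_eq_tsum, lp.inner_eq_tsum]
    refine tsum_congr fun g => ?_
    simp [regularRep_apply, map_star, ContinuousLinearMap.star_eq_adjoint,
      ContinuousLinearMap.adjoint_inner_left]

theorem regularRepHom_apply (a : A) (ξ : EllTwo G H) (g : G) :
    regularRepHom α π a ξ g = π (α g⁻¹ a) (ξ g) := rfl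

theorem translation_mul_regularRepHom (s : G) (a : A) :
    translation s * regularRepHom α π a = regularRepHom α π (α s a) * translation s := by
  ext ξ g
  simp [translation_apply, regularRepHom_apply]

theorem regularRepHom_mem (a : A) : regularRepHom α π a ∈ reducedCrossedProduct α π :=
  subset_closure (StarAlgebra.subset_adjoin ℂ _ (Or.inl ⟨a, rfl⟩))

theorem translation_mem (s : G) : translation s ∈ reducedCrossedProduct α π :=
  subset_closure (StarAlgebra.subset_adjoin ℂ _ (Or.inr ⟨s, rfl⟩))

/-- The algebraic crossed product: the span of the operators `π̃(a) u_s`. -/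
noncomputable def algebraicCrossedProduct : Submodule ℂ (EllTwo G H →L[ℂ] EllTwo G H) :=
  Submodule.span ℂ (Set.range fun p : A × G => regularRepHom α π p.1 * translation p.2)

variable {α π} in
theorem mul_mem_algebraicCrossedProduct {S T : EllTwo G H →L[ℂ] EllTwo G H}
    (hS : S ∈ algebraicCrossedProduct α π) (hT : T ∈ algebraicCrossedProduct α π) :
    S * T ∈ algebraicCrossedProduct α π := by
  have h := Submodule.mul_mem_mul hS hT
  rw [algebraicCrossedProduct, Submodule.span_mul_span] at h
  refine Submodule.span_mono ?_ h
  rintro _ ⟨_, ⟨⟨a, s⟩, rfl⟩, _, ⟨⟨b, t⟩, rfl⟩, rfl⟩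
  refine ⟨(a * α s b, s * t), ?_⟩
  simp only [map_mul, translation_mul]
  rw [mul_assoc, mul_assoc, ← mul_assoc (regularRepHom α π (α s b)),
    ← translation_mul_regularRepHom, mul_assoc]

variable {α π} in
theorem star_mem_algebraicCrossedProduct {T : EllTwo G H →L[ℂ] EllTwo G H}
    (hT : T ∈ algebraicCrossedProduct α π) : star T ∈ algebraicCrossedProduct α π := by
  induction hT using Submodule.span_induction with
  | mem x h =>
    obtain ⟨⟨a, s⟩, rfl⟩ := h
    refine Submodule.subset_span ⟨(α s⁻¹ (star a), s⁻¹), ?_⟩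
    simp only [star_mul, adjoint_translation, ← map_star, translation_mul_regularRepHom]
  | zero => simp
  | add x y _ _ hx hy => rw [star_add]; exact add_mem hx hy
  | smul c x _ hx => rw [star_smul]; exact Submodule.smul_mem _ _ hx

theorem adjoin_subset_algebraicCrossedProduct :
    (StarAlgebra.adjoin ℂ (Set.range (regularRep α π) ∪
      Set.range (translation : G → EllTwo G H →L[ℂ] EllTwo G H)) :
        Set (EllTwo G H →L[ℂ] EllTwo G H)) ⊆
      (algebraicCrossedProduct α π : Set (EllTwo G H →L[ℂ] EllTwo G H)) := by
  have key (a : A) : regularRepHom α π a ∈ algebraicCrossedProduct α π :=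
    Submodule.subset_span ⟨(a, 1), by simp [translation_one]⟩
  intro T hT
  induction hT using StarAlgebra.adjoin_induction with
  | mem x h =>
    rcases h with ⟨a, rfl⟩ | ⟨s, rfl⟩
    · exact key a
    · exact Submodule.subset_span ⟨(1, s), by simp⟩
  | algebraMap r => exact AlgHomClass.commutes (regularRepHom α π) r ▸ key _
  | add x y _ _ hx hy => exact add_mem hx hy
  | mul x y _ _ hx hy => exact mul_mem_algebraicCrossedProduct hx hy
  | star x _ hx => exact star_mem_algebraicCrossedProduct hx

theorem reducedCrossedProduct_subset_closure :
    (reducedCrossedProduct α π : Set (EllTwo G H →L[ℂ] EllTwo G H)) ⊆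
      closure (algebraicCrossedProduct α π) :=
  closure_mono (adjoin_subset_algebraicCrossedProduct α π)

theorem entry_regularRepHom_mul (a : A) (T : EllTwo G H →L[ℂ] EllTwo G H) :
    entry (regularRepHom α π a * T) = π a * entry T := by
  ext v
  simp [entry_apply, regularRepHom_apply]

theorem entry_mul_regularRepHom (a : A) (T : EllTwo G H →L[ℂ] EllTwo G H) :
    entry (T * regularRepHom α π a) = entry T * π a := by
  classical
  ext v
  have h : regularRepHom α π a (lp.single 2 1 v) = lp.single 2 (1 : G) (π a v) := by
    ext1
    funext g
    by_cases hg : g = 1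
    · subst hg; simp [regularRepHom_apply]
    · simp [regularRepHom_apply, hg]
  simp only [entry_apply, mul_apply_eq_comp, h]

/-- On the dense span this is read off from the generators; it passes to the closure because an
injective `π` is isometric and so has closed range. -/
theorem entry_mem_range (hπ : Function.Injective π) {T : EllTwo G H →L[ℂ] EllTwo G H}
    (hT : T ∈ reducedCrossedProduct α π) : entry T ∈ Set.range π := by
  have hcl : IsClosed (Set.range π) :=
    (NonUnitalStarAlgHom.isometry π hπ).isClosedEmbedding.isClosed_range
  refine closure_minimal ?_ (hcl.preimage continuous_entry)
    (reducedCrossedProduct_subset_closure α π hT)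
  intro T hT
  change entry T ∈ π.range
  induction hT using Submodule.span_induction with
  | mem x h =>
    obtain ⟨⟨a, s⟩, rfl⟩ := h
    rw [entry_regularRepHom_mul]
    by_cases hs : s = 1
    · subst hs; rw [translation_one, entry_one]; exact ⟨a, by simp⟩
    · rw [entry_translation hs, mul_zero]; exact zero_mem _
  | zero => rw [map_zero]; exact zero_mem _
  | add x y _ _ hx hy => rw [map_add]; exact add_mem hx hy
  | smul c x _ hx => rw [map_smul]; exact Subalgebra.smul_mem _ hx _

/-- Faithfulness of the expectation: pairing this coefficient with `v` gives `‖T (lp.single 2 s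
v)‖²`, and the vectors `lp.single 2 s v` determine `T`. -/
theorem exists_entry_star_mul_ne_zero {T : EllTwo G H →L[ℂ] EllTwo G H} (hT : T ≠ 0) :
    ∃ s : G, entry (star (T * translation s) * (T * translation s)) ≠ 0 := by
  classical
  by_contra! h
  refine hT (lp.ext_continuousLinearMap (by norm_num) fun s => ?_)
  ext1 v
  have hv : (translation s : EllTwo G H →L[ℂ] EllTwo G H) (lp.single 2 1 v) = lp.single 2 s v := by
    ext g
    by_cases hg : g = s
    · subst hg; simp [translation_apply]
    · have : s⁻¹ * g ≠ 1 := fun h => hg (inv_mul_eq_one.1 h).symm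
      simp [translation_apply, hg, this]
  have h0 : inner ℂ v (entry (star (T * translation s) * (T * translation s)) v) = 0 := by
    rw [h s]; simp
  rw [entry_apply, ← lp.inner_single_left (𝕜 := ℂ) (G := fun _ : G => H),
    mul_apply_eq_comp, ContinuousLinearMap.star_eq_adjoint,
    ContinuousLinearMap.adjoint_inner_right, inner_self_eq_zero, mul_apply_eq_comp,
    hv] at h0
  simpa using h0

end CrossedProduct

/-! ### Central scalar functions in `C(X, D)`. -/

section Over

variable {G X D : Type*} [Group G] [TopologicalSpace X] [CStarAlgebra D]

/-- Complex valued functions as central elements of `C(X, D)`. -/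
noncomputable def scalar : C(X, ℂ) →ₐ[ℂ] C(X, D) :=
  (Algebra.ofId ℂ D).compLeftContinuous ℂ (algebraMapCLM ℂ D).continuous

theorem scalar_apply (f : C(X, ℂ)) (x : X) :
    (scalar f : C(X, D)) x = algebraMap ℂ D (f x) := rfl

theorem scalar_mul_comm (f : C(X, ℂ)) (a : C(X, D)) : scalar f * a = a * scalar f := by
  ext x
  exact Algebra.commutes _ _

theorem norm_scalar_le_one [CompactSpace X] {f : C(X, ℂ)} (hf : ∀ x, ‖f x‖ ≤ 1) :
    ‖(scalar f : C(X, D))‖ ≤ 1 := by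
  refine (ContinuousMap.norm_le _ zero_le_one).2 fun x => ?_
  rw [scalar_apply]
  -- In the zero algebra the unit has norm 0, so `norm_algebraMap'` needs `D` nontrivial.
  cases subsingleton_or_nontrivial D
  · rw [Subsingleton.elim (algebraMap ℂ D (f x)) 0, norm_zero]; exact zero_le_one
  · rw [norm_algebraMap']; exact hf x

theorem norm_scalar_mul_mul_scalar_le [CompactSpace X] {f : C(X, ℂ)} (hf : ∀ x, ‖f x‖ ≤ 1)
    {a : C(X, D)} {r : ℝ} (hr : 0 ≤ r) (ha : ∀ x, f x ≠ 0 → ‖a x‖ ≤ r) :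
    ‖scalar f * a * scalar f‖ ≤ r := by
  refine (ContinuousMap.norm_le _ hr).2 fun x => ?_
  by_cases hx : f x = 0
  · simp [scalar_apply, hx, hr]
  · have h1 : ‖(scalar f : C(X, D)) x‖ ≤ 1 :=
      (ContinuousMap.norm_coe_le_norm _ x).trans (norm_scalar_le_one hf)
    rw [ContinuousMap.mul_apply, ContinuousMap.mul_apply]
    calc _ ≤ ‖(scalar f : C(X, D)) x‖ * ‖a x‖ * ‖(scalar f : C(X, D)) x‖ :=
          (norm_mul_le _ _).trans (by gcongr; exact norm_mul_le _ _)
      _ ≤ 1 * r * 1 := by gcongr; exact ha x hx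
      _ = r := by ring

variable [MulAction G X] [ContinuousConstSMul G X]

/-- The function `x ↦ f (g⁻¹ x)`. -/
noncomputable def translate (g : G) (f : C(X, ℂ)) : C(X, ℂ) :=
  f.comp ⟨fun x => g⁻¹ • x, continuous_const_smul _⟩

/-- The fibre automorphisms fix scalars, so only the action on `X` remains. -/
theorem LiesOver.apply_scalar [CompactSpace X] {α : G →* (C(X, D) ≃⋆ₐ[ℂ] C(X, D))}
    (hα : LiesOver α) (g : G) (f : C(X, ℂ)) : α g (scalar f) = scalar (translate g f) := by
  obtain ⟨β, hβ⟩ := hα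
  ext x
  rw [hβ, scalar_apply, AlgHomClass.commutes]
  rfl

end Over

/-! ### Neighbourhoods disjoint from finitely many translates. -/

section Translates

variable {G X : Type*} [Group G] [TopologicalSpace X] [MulAction G X] [ContinuousConstSMul G X]
  [T2Space X]

theorem exists_isOpen_disjoint_translates {S : Finset G} {x : X}
    (hx : ∀ g ∈ S, g • x ≠ x) {V : Set X} (hV : IsOpen V) (hxV : x ∈ V) :
    ∃ U ⊆ V, IsOpen U ∧ x ∈ U ∧ ∀ g ∈ S, ∀ y ∈ U, g⁻¹ • y ∉ U := by
  have key : ∀ g ∈ S, ∃ U : Set X, IsOpen U ∧ x ∈ U ∧ ∀ y ∈ U, g⁻¹ • y ∉ U := by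
    intro g hg
    have hne : x ≠ g⁻¹ • x := fun h => hx g hg (eq_inv_smul_iff.1 h)
    obtain ⟨A, B, hA, hB, hxA, hxB, hAB⟩ := t2_separation hne
    exact ⟨A ∩ (fun y => g⁻¹ • y) ⁻¹' B, hA.inter (hB.preimage (continuous_const_smul _)),
      ⟨hxA, hxB⟩, fun y hy hy' => Set.disjoint_left.1 hAB hy'.1 hy.2⟩
  choose! U hU hxU hdis using key
  refine ⟨V ∩ ⋂ g ∈ S, U g, Set.inter_subset_left,
    hV.inter (isOpen_biInter_finset hU), ⟨hxV, Set.mem_iInter₂.2 hxU⟩, fun g hg y hy hy' => ?_⟩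
  exact hdis g hg y (Set.mem_iInter₂.1 hy.2 g hg) (Set.mem_iInter₂.1 hy'.2 g hg)

end Translates

/-! ### Ideals of the reduced crossed product. -/

section Ideals

variable {G A H : Type*} [Group G] [CStarAlgebra A]
  [NormedAddCommGroup H] [InnerProductSpace ℂ H] [CompleteSpace H]
  (α : G →* (A ≃⋆ₐ[ℂ] A)) (π : A →⋆ₐ[ℂ] (H →L[ℂ] H))

/-- The embedding of the coefficient algebra into the reduced crossed product. -/
noncomputable def coeff : A →⋆ₐ[ℂ] reducedCrossedProduct α π :=
  (regularRepHom α π).codRestrict _ (regularRepHom_mem α π)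

/-- The canonical unitaries of the reduced crossed product. -/
noncomputable def canonicalUnitary (s : G) : reducedCrossedProduct α π :=
  ⟨translation s, translation_mem α π s⟩

theorem canonicalUnitary_mul_coeff_mul_canonicalUnitary (s : G) (a : A) :
    canonicalUnitary α π s * coeff α π a * canonicalUnitary α π s⁻¹ = coeff α π (α s a) := by
  refine Subtype.ext ?_
  change translation s * regularRepHom α π a * translation s⁻¹ = regularRepHom α π (α s a)
  rw [translation_mul_regularRepHom, mul_assoc, ← translation_mul, mul_inv_cancel,
    translation_one, mul_one]

variable {α π}

theorem exists_mem_entry_ne_zero (hπ : Function.Injective π)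
    {I : TwoSidedIdeal (reducedCrossedProduct α π)} (hI : I ≠ ⊥) :
    ∃ y ∈ I, ∃ c : A, entry (y : EllTwo G H →L[ℂ] EllTwo G H) = π c ∧ c ≠ 0 := by
  obtain ⟨a, ha, ha0⟩ : ∃ a ∈ I, a ≠ 0 := by
    by_contra! h
    exact hI (le_bot_iff.1 fun a ha => (TwoSidedIdeal.mem_bot _).2 (h a ha))
  obtain ⟨s, hs⟩ := exists_entry_star_mul_ne_zero (T := (a : EllTwo G H →L[ℂ] EllTwo G H))
    (fun h => ha0 (Subtype.ext h))
  have hy : star (a * canonicalUnitary α π s) * (a * canonicalUnitary α π s) ∈ I :=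
    I.mul_mem_left _ _ (I.mul_mem_right _ _ ha)
  obtain ⟨c, hc⟩ := entry_mem_range α π hπ
    (star (a * canonicalUnitary α π s) * (a * canonicalUnitary α π s)).2
  refine ⟨_, hy, c, hc.symm, fun h0 => hs ?_⟩
  rw [h0, map_zero] at hc
  exact hc.symm

theorem nontrivial_reducedCrossedProduct [Nontrivial A] (hπ : Function.Injective π) :
    Nontrivial (reducedCrossedProduct α π) := by
  refine ⟨⟨1, 0, fun h => one_ne_zero (α := A) (hπ ?_)⟩⟩
  have h' : (1 : EllTwo G H →L[ℂ] EllTwo G H) = 0 := congrArg Subtype.val h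
  rw [map_one, map_zero, ← entry_one (G := G), h', map_zero]

end Ideals

/-! ### From a nonzero ideal to the unit. -/

section Main

variable {G X D H : Type*} [Group G] [TopologicalSpace X] [CompactSpace X]
  [CStarAlgebra D] [NormedAddCommGroup H] [InnerProductSpace ℂ H] [CompleteSpace H]
  {α : G →* (C(X, D) ≃⋆ₐ[ℂ] C(X, D))} {π : C(X, D) →⋆ₐ[ℂ] (H →L[ℂ] H)}

/-- Values at a point of matrix coefficients of a nonzero ideal form a two-sided ideal of the
fibre; if the fibre is simple, this ideal is dense, so it approximates the unit. -/
theorem exists_mem_norm_entry_sub_one_lt (hD : IsSimpleCStar D)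
    {I : TwoSidedIdeal (reducedCrossedProduct α π)} {y : reducedCrossedProduct α π} (hy : y ∈ I)
    {c : C(X, D)} (hc : entry (y : EllTwo G H →L[ℂ] EllTwo G H) = π c) {x : X} (hx : c x ≠ 0)
    {ε : ℝ} (hε : 0 < ε) :
    ∃ y ∈ I, ∃ c : C(X, D), entry (y : EllTwo G H →L[ℂ] EllTwo G H) = π c ∧ ‖c x - 1‖ < ε := by
  set N : Set D := {d | ∃ y ∈ I, ∃ c : C(X, D),
    entry (y : EllTwo G H →L[ℂ] EllTwo G H) = π c ∧ c x = d} with hN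
  have hleft (d e : D) (he : e ∈ N) : d * e ∈ N := by
    obtain ⟨y, hy, c, hc, rfl⟩ := he
    refine ⟨coeff α π (.const X d) * y, I.mul_mem_left _ _ hy, .const X d * c, ?_, rfl⟩
    rw [map_mul, ← hc]
    exact entry_regularRepHom_mul α π _ _
  have hright (d e : D) (he : e ∈ N) : e * d ∈ N := by
    obtain ⟨y, hy, c, hc, rfl⟩ := he
    refine ⟨y * coeff α π (.const X d), I.mul_mem_right _ _ hy, c * .const X d, ?_, rfl⟩
    rw [map_mul, ← hc]
    exact entry_mul_regularRepHom α π _ _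
  have hadd (d : D) (hd : d ∈ N) (e : D) (he : e ∈ N) : d + e ∈ N := by
    obtain ⟨y, hy, c, hc, rfl⟩ := hd
    obtain ⟨y', hy', c', hc', rfl⟩ := he
    refine ⟨y + y', I.add_mem hy hy', c + c', ?_, rfl⟩
    rw [map_add, ← hc, ← hc', ← map_add]
    rfl
  have hzero : (0 : D) ∈ N := ⟨0, I.zero_mem, 0, by simp, rfl⟩
  let J : TwoSidedIdeal D := TwoSidedIdeal.mk' (closure N) (subset_closure hzero)
    (fun h h' => map_mem_closure₂ continuous_add h h' hadd)
    (fun h => map_mem_closure continuous_neg h fun d hd => by simpa using hleft (-1) d hd)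
    (fun {d _} h => map_mem_closure (continuous_const_mul d) h (hleft d))
    (fun {_ d} h => map_mem_closure (f := (· * d)) (continuous_mul_const d) h (hright d))
  have hJ : (J : Set D) = closure N := TwoSidedIdeal.coe_mk' ..
  have h1 : (1 : D) ∈ closure N := by
    rcases hD.2 J (hJ ▸ isClosed_closure) with h | h
    · have : c x ∈ (J : Set D) := hJ ▸ subset_closure ⟨y, hy, c, hc, rfl⟩
      rw [h] at this
      exact absurd ((TwoSidedIdeal.mem_bot _).1 this) hx
    · rw [← hJ, h]
      trivial
  obtain ⟨_, ⟨y, hy, c, hc, rfl⟩, hlt⟩ := Metric.mem_closure_iff.1 h1 ε hε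
  exact ⟨y, hy, c, hc, by rwa [dist_comm, dist_eq_norm] at hlt⟩

variable [MulAction G X] [ContinuousConstSMul G X]

/-- Compression by a function whose support is moved off itself by finitely many group elements
turns an element of the algebraic crossed product into its coefficient at the identity. -/
theorem exists_compression (hα : LiesOver α) {b : EllTwo G H →L[ℂ] EllTwo G H}
    (hb : b ∈ algebraicCrossedProduct α π) :
    ∃ S : Finset G, 1 ∉ S ∧ ∃ c : C(X, D), entry b = π c ∧
      ∀ f : C(X, ℂ), (∀ g ∈ S, ∀ x, f x * f (g⁻¹ • x) = 0) →
        regularRepHom α π (scalar f) * b * regularRepHom α π (scalar f) =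
          regularRepHom α π (scalar f * c * scalar f) := by
  classical
  induction hb using Submodule.span_induction with
  | mem x h =>
    obtain ⟨⟨a, s⟩, rfl⟩ := h
    by_cases hs : s = 1
    · subst hs
      refine ⟨∅, by simp, a, ?_, fun f _ => ?_⟩
      · change entry (regularRepHom α π a * translation 1) = π a
        rw [entry_regularRepHom_mul, translation_one, entry_one, mul_one]
      · simp [translation_one]
    · refine ⟨{s}, by simpa using Ne.symm hs, 0, ?_, fun f hf => ?_⟩
      · simp [entry_regularRepHom_mul, entry_translation hs]
      -- Moving the right-hand `f` past `u_s` turns it into its translate; centrality brings it next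
      -- to the left-hand `f`, where the product vanishes.
      · have h0 : scalar f * (a * scalar (translate s f)) = 0 := by
          rw [← scalar_mul_comm, ← mul_assoc, ← map_mul]
          have : f * translate s f = 0 := by
            ext x
            exact hf s (by simp) x
          rw [this, map_zero, zero_mul]
        have : regularRepHom α π (scalar f) * (regularRepHom α π a * translation s) *
            regularRepHom α π (scalar f) =
            regularRepHom α π (scalar f * (a * scalar (translate s f))) * translation s := by
          simp only [mul_assoc, translation_mul_regularRepHom, hα.apply_scalar, map_mul]
        simp [this, h0]
  | zero => exact ⟨∅, by simp, 0, by simp, fun f _ => by simp⟩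
  | add b b' _ _ h h' =>
    obtain ⟨S, hS, c, hc, hf⟩ := h
    obtain ⟨S', hS', c', hc', hf'⟩ := h'
    refine ⟨S ∪ S', by simp [hS, hS'], c + c', by simp [hc, hc'], fun f hfS => ?_⟩
    rw [mul_add, add_mul, hf f fun g hg => hfS g (by simp [hg]),
      hf' f fun g hg => hfS g (by simp [hg]), ← map_add, mul_add, add_mul]
  | smul r b _ h =>
    obtain ⟨S, hS, c, hc, hf⟩ := h
    refine ⟨S, hS, r • c, by simp [hc], fun f hfS => ?_⟩
    rw [mul_smul_comm, smul_mul_assoc, hf f hfS, ← map_smul, mul_smul_comm, smul_mul_assoc]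

/-- With `z = f² - f y f` of norm less than 1 and `k f = k`, one has `k (1 - z) = k f y f ∈ I`, and
`1 - z` is invertible. Keeping `k` real and nonnegative prevents cancellation when translates are
added. -/
theorem exists_nonneg_scalar_mem [T2Space X]
    (hfree : ∀ S : Finset G, 1 ∉ S → Dense {x : X | ∀ g ∈ S, g • x ≠ x})
    (hα : LiesOver α) (hπ : Function.Injective π)
    {I : TwoSidedIdeal (reducedCrossedProduct α π)} {y : reducedCrossedProduct α π} (hy : y ∈ I)
    {c : C(X, D)} (hc : entry (y : EllTwo G H →L[ℂ] EllTwo G H) = π c) {x₀ : X}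
    (hx₀ : ‖c x₀ - 1‖ < 1 / 4) :
    ∃ k : C(X, ℝ), (∀ x, 0 ≤ k x) ∧ (∃ x, k x ≠ 0) ∧
      ∀ k' : C(X, ℂ), (∀ x, k' x = k x) → coeff α π (scalar k') ∈ I := by
  obtain ⟨b, hb, hyb⟩ := Metric.mem_closure_iff.1
    (reducedCrossedProduct_subset_closure α π y.2) (1 / 4) (by norm_num)
  rw [dist_eq_norm] at hyb
  obtain ⟨S, hS, cb, hcb, hcomp⟩ := exists_compression hα hb
  have hcc (x : X) : ‖c x - cb x‖ ≤ 1 / 4 := by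
    refine ((c - cb).norm_coe_le_norm x).trans ?_
    rw [← NonUnitalStarAlgHom.norm_map π hπ, map_sub, ← hc, ← hcb, ← map_sub]
    exact (norm_entry_le _).trans hyb.le
  have hVo : IsOpen {x | ‖c x - 1‖ < 1 / 4} :=
    isOpen_lt ((c.continuous.sub continuous_const).norm) continuous_const
  -- The point `x₀` may be fixed by elements of `S`; density replaces it by a nearby point that is
  -- not.
  obtain ⟨x, hxV, hxS⟩ := (hfree S hS).inter_open_nonempty _ hVo ⟨x₀, hx₀⟩
  obtain ⟨U, hUV, hU, hxU, hdis⟩ := exists_isOpen_disjoint_translates hxS hVo hxV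
  obtain ⟨φ, hφ0, hφ1, hφ⟩ := exists_continuous_zero_one_of_isClosed hU.isClosed_compl
    (isClosed_singleton (x := x)) (by simpa using hxU)
  have hφU (z : X) (hz : z ∉ U) : φ z = 0 := hφ0 hz
  -- This `f` equals 1 where `φ ≥ 1/2`, which contains the support of the later `k = max 0 (2φ -
  -- 1)`; hence `k f = k`.
  let f : C(X, ℂ) := ⟨fun z => ((min 1 (2 * φ z) : ℝ) : ℂ), by fun_prop⟩
  have hfz (z : X) : f z = ((min 1 (2 * φ z) : ℝ) : ℂ) := rfl
  have hfU (z : X) (hz : z ∉ U) : f z = 0 := by simp [hfz, hφU z hz]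
  have hf1 (z : X) : ‖f z‖ ≤ 1 := by
    rw [hfz, Complex.norm_real, Real.norm_eq_abs, abs_le]
    have := (hφ z).1
    exact ⟨by linarith [le_min zero_le_one (by linarith : 0 ≤ 2 * φ z)], min_le_left _ _⟩
  have hFb := hcomp f fun g hg z => by
    by_cases hz : z ∈ U
    · rw [hfU _ (hdis g hg z hz), mul_zero]
    · rw [hfU z hz, zero_mul]
  let F := coeff α π (scalar f)
  let z := F * F - F * y * F
  have hF : ‖regularRepHom α π (scalar f)‖ ≤ 1 :=
    (NonUnitalStarAlgHom.norm_apply_le _ _).trans (norm_scalar_le_one hf1)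
  -- The bound is 3/4: 1/4 for `c` against 1 on `U`, 1/4 for `c` against `cb`, and 1/4 for `y`
  -- against `b`.
  have hz : ‖z‖ < 1 := by
    have h1 : ‖regularRepHom α π (scalar f * (1 - cb) * scalar f)‖ ≤ 1 / 2 := by
      refine (NonUnitalStarAlgHom.norm_apply_le _ _).trans
        (norm_scalar_mul_mul_scalar_le hf1 (by norm_num) fun w hw => ?_)
      have hwU : ‖c w - 1‖ < 1 / 4 := hUV (not_imp_comm.1 (hfU w) hw)
      calc ‖(1 - cb) w‖ = ‖(c w - cb w) - (c w - 1)‖ := by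
            rw [ContinuousMap.sub_apply, ContinuousMap.one_apply]; congr 1; abel
        _ ≤ 1 / 4 + 1 / 4 := (norm_sub_le _ _).trans (add_le_add (hcc w) hwU.le)
        _ = 1 / 2 := by norm_num
    have h2 : ‖regularRepHom α π (scalar f) * ((y : EllTwo G H →L[ℂ] EllTwo G H) - b) *
        regularRepHom α π (scalar f)‖ ≤ 1 / 4 := by
      calc _ ≤ ‖regularRepHom α π (scalar f)‖ * ‖(y : EllTwo G H →L[ℂ] EllTwo G H) - b‖ *
            ‖regularRepHom α π (scalar f)‖ :=
            (norm_mul_le _ _).trans (by gcongr; exact norm_mul_le _ _)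
        _ ≤ 1 * (1 / 4) * 1 := by gcongr
        _ = 1 / 4 := by norm_num
    have h3 : (z : EllTwo G H →L[ℂ] EllTwo G H) =
        regularRepHom α π (scalar f * (1 - cb) * scalar f) -
        regularRepHom α π (scalar f) * ((y : EllTwo G H →L[ℂ] EllTwo G H) - b) *
        regularRepHom α π (scalar f) := by
      have : (z : EllTwo G H →L[ℂ] EllTwo G H) =
        regularRepHom α π (scalar f) * regularRepHom α π (scalar f) -
        regularRepHom α π (scalar f) * (y : EllTwo G H →L[ℂ] EllTwo G H) *
        regularRepHom α π (scalar f) := rfl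
      rw [this, mul_sub, sub_mul, mul_sub, sub_mul, hFb, mul_one, map_sub, map_mul]
      abel
    change ‖(z : EllTwo G H →L[ℂ] EllTwo G H)‖ < 1
    rw [h3]
    exact (norm_sub_le _ _).trans_lt (by linarith)
  refine ⟨⟨fun z => max 0 (2 * φ z - 1), by fun_prop⟩, fun z => le_max_left _ _, ⟨x, ?_⟩, ?_⟩
  · have : φ x = 1 := hφ1 rfl
    simp [this]
    norm_num
  · intro k hk
    have hkf : k * f = k := by
      ext z
      simp only [ContinuousMap.mul_apply, hk, hfz, ContinuousMap.coe_mk, ← Complex.ofReal_mul]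
      congr 1
      rcases le_total (2 * φ z) 1 with h | h
      · simp [max_eq_left (show 2 * φ z - 1 ≤ 0 by linarith)]
      · simp [min_eq_left h]
    have hKF : coeff α π (scalar k) * F = coeff α π (scalar k) := by
      rw [← map_mul, ← map_mul, hkf]
    have : CompleteSpace (reducedCrossedProduct α π) :=
      (StarSubalgebra.isClosed_topologicalClosure _).completeSpace_coe
    obtain ⟨u, hu⟩ := isUnit_one_sub_of_norm_lt_one hz
    have hmem : coeff α π (scalar k) * (u : reducedCrossedProduct α π) ∈ I := by
      have : coeff α π (scalar k) * (u : reducedCrossedProduct α π) =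
          coeff α π (scalar k) * F * y * F := by
        rw [hu, mul_sub, mul_one, mul_sub, ← mul_assoc, hKF, hKF, sub_sub_cancel, ← mul_assoc,
          ← mul_assoc, hKF]
      rw [this]
      exact I.mul_mem_right _ _ (I.mul_mem_left _ _ hy)
    simpa using I.mul_mem_right _ (↑u⁻¹ : reducedCrossedProduct α π) hmem

/-- By minimality the translates of the open set where `k ≠ 0` cover `X`, and finitely many suffice.
The sum of the matching translates of `k` is positive everywhere, hence invertible, and `I` is
stable under conjugation by the `u_s`. -/
theorem one_mem_of_scalar_mem [MulAction.IsMinimal G X] (hα : LiesOver α)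
    {I : TwoSidedIdeal (reducedCrossedProduct α π)} {k : C(X, ℝ)} (hk : ∀ x, 0 ≤ k x)
    (hk0 : ∃ x, k x ≠ 0) {k' : C(X, ℂ)} (hkk' : ∀ x, k' x = k x)
    (hI : coeff α π (scalar k') ∈ I) : 1 ∈ I := by
  obtain ⟨F, hF⟩ := isCompact_univ.exists_finite_cover_smul G
    (isOpen_ne_fun k.continuous continuous_const) hk0
  have hmem (s : G) : coeff α π (scalar (translate s k')) ∈ I := by
    rw [← hα.apply_scalar, ← canonicalUnitary_mul_coeff_mul_canonicalUnitary]
    exact I.mul_mem_right _ _ (I.mul_mem_left _ _ hI)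
  have hunit : IsUnit (∑ s ∈ F, translate s k') := by
    refine (ContinuousMap.isUnit_iff_forall_ne_zero _).2 fun x => ?_
    have hsum : (∑ s ∈ F, translate s k') x = ((∑ s ∈ F, k (s⁻¹ • x) : ℝ) : ℂ) := by
      rw [ContinuousMap.sum_apply, Complex.ofReal_sum]
      exact Finset.sum_congr rfl fun s _ => hkk' _
    rw [hsum, Complex.ofReal_ne_zero]
    obtain ⟨s, hs, hx⟩ := Set.mem_iUnion₂.1 (hF (Set.mem_univ x))
    refine (Finset.sum_pos' (fun s _ => hk _) ⟨s, hs, ?_⟩).ne'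
    exact (hk _).lt_of_ne' (Set.mem_smul_set_iff_inv_smul_mem.1 hx)
  obtain ⟨u, hu⟩ := (hunit.map scalar).map (coeff α π)
  have hu' : (u : reducedCrossedProduct α π) ∈ I := by
    rw [hu, map_sum, map_sum]
    exact sum_mem fun s _ => hmem s
  simpa using I.mul_mem_left (↑u⁻¹ : reducedCrossedProduct α π) _ hu'

end Main

end ReducedCrossedProduct

theorem mainTheorem10 {G X D H : Type*} [Group G]
    [TopologicalSpace X] [CompactSpace X] [T2Space X] [Nonempty X]
    [MulAction G X] [ContinuousConstSMul G X] [MulAction.IsMinimal G X]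
    (hfree : ∀ S : Finset G, 1 ∉ S → Dense {x : X | ∀ g ∈ S, g • x ≠ x})
    [CStarAlgebra D] (hD : ReducedCrossedProduct.IsSimpleCStar D)
    (α : G →* (C(X, D) ≃⋆ₐ[ℂ] C(X, D))) (hα : ReducedCrossedProduct.LiesOver α)
    [NormedAddCommGroup H] [InnerProductSpace ℂ H] [CompleteSpace H]
    (π : C(X, D) →⋆ₐ[ℂ] (H →L[ℂ] H)) (hπ : Function.Injective π) :
    ReducedCrossedProduct.IsSimpleCStar (ReducedCrossedProduct.reducedCrossedProduct α π) := by
  have := hD.1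
  refine ⟨ReducedCrossedProduct.nontrivial_reducedCrossedProduct hπ, fun I _ => ?_⟩
  refine or_iff_not_imp_left.2 fun hI => ?_
  obtain ⟨y₀, hy₀, c₀, hc₀, hne⟩ := ReducedCrossedProduct.exists_mem_entry_ne_zero hπ hI
  obtain ⟨x₀, hx₀⟩ : ∃ x, c₀ x ≠ 0 := by
    by_contra! h
    exact hne (ContinuousMap.ext h)
  obtain ⟨y, hy, c, hc, hlt⟩ := ReducedCrossedProduct.exists_mem_norm_entry_sub_one_lt hD hy₀ hc₀
    hx₀ (by norm_num : (0 : ℝ) < 1 / 4)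
  obtain ⟨k, hk, hk0, hmem⟩ :=
    ReducedCrossedProduct.exists_nonneg_scalar_mem hfree hα hπ hy hc hlt
  let k' : C(X, ℂ) := ⟨fun x => (k x : ℂ), by fun_prop⟩
  exact I.one_mem_iff.1 (ReducedCrossedProduct.one_mem_of_scalar_mem hα hk hk0 (k' := k')
    (fun _ => rfl) (hmem k' fun _ => rfl))
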